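/- Let $\overline{\Omega}_2$ be the following monoidal category (pruned trees of height $2$). Its objects are surjections $t:T_2\to T_1$ (not necessarily order-preserving) of finite totally ordered sets. A morphism from $s:S_2\to S_1$ to $t:T_2\to T_1$ is a pair of maps $f_2:S_2\to T_2$, $f_1:S_1\to T_1$ with $t f_2=f_1 s$, such that $f_1$ is (weakly) order-preserving and, for every $x\in S_1$, the restriction $f_2:s^{-1}(x)\to t^{-1}(f_1(x))$ is order-preserving. The tensor product is the ordered sum $(S_2\to S_1)\otimes(T_2\to T_1)=(S_2\sqcup T_2\to S_1\sqcup T_1)$, and the unit object is $\emptyset\to\emptyset$. For a monoidal category $\mathcal C$, let $\mathbf{Mon}(\mathcal C)$ be the category of monoids in $\mathcal C$. A cosimplicial monoid in $\mathcal C$ is a functor from the category of finite nonempty ordinals $[n]=\{1,\dots,n\}$, $n\ge 1$, and order-preserving maps to $\mathbf{Mon}(\mathcal C)$; morphisms of cosimplicial monoids are natural transformations. For $n\ge1$ let $S^n=([n]\to[1])\in\overline{\Omega}_2$, with multiplication $S^n\otimes S^n\to S^n$ given on leaves by the codiagonal $[n]\sqcup[n]\to[n]$, and with unit the unique morphism $(\emptyset\to\emptyset)\to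 S^n$. An order-preserving map $[n]\to[m]$ induces a homomorphism of monoids $S^n\to S^m$, so that $S^*$ is a cosimplicial monoid in $\overline{\Omega}_2$. **Proposition.** The monoidal category $\overline{\Omega}_2$ is the free monoidal category containing a cosimplicial monoid. That is, for every monoidal category $\mathcal C$, evaluation at $S^*$, $$F\longmapsto F(S^*),$$ is an equivalence from the category of strong monoidal functors $\overline{\Omega}_2\to\mathcal C$ and monoidal natural transformations to the category of cosimplicial monoids in $\mathcal C$. -/

import Mathlib

open CategoryTheory MonoidalCategory

universe v u v' u'

/-- A pruned tree of height two: a surjection, not necessarily monotone, of finite totally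
ordered sets. -/
structure PrunedTree where
  /-- the ordered set of leaves (vertices of height two) -/
  Top : Type
  /-- the ordered set of vertices of height one -/
  Mid : Type
  [topOrder : LinearOrder Top]
  [midOrder : LinearOrder Mid]
  [topFinite : Finite Top]
  [midFinite : Finite Mid]
  /-- the structure map -/
  proj : Top → Mid
  surj : Function.Surjective proj

namespace PrunedTree

attribute [instance] topOrder midOrder topFinite midFinite

/-- A map of trees: a commutative square whose lower map is order-preserving and whose upper map
is order-preserving on the fibres of the source. -/
@[ext]
structure Hom (S T : PrunedTree) where
  top : S.Top → T.Top
  mid : S.Mid → T.Mid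
  comm : ∀ a, T.proj (top a) = mid (S.proj a)
  mid_mono : Monotone mid
  top_mono : ∀ a b, S.proj a = S.proj b → a ≤ b → top a ≤ top b

instance : Category PrunedTree where
  Hom := Hom
  id S :=
    { top := fun a => a
      mid := fun x => x
      comm := fun _ => rfl
      mid_mono := fun _ _ h => h
      top_mono := fun _ _ _ h => h }
  comp {S T U} f g :=
    { top := fun a => g.top (f.top a)
      mid := fun x => g.mid (f.mid x)
      comm := fun a => by rw [g.comm, f.comm]
      mid_mono := fun _ _ h => g.mid_mono (f.mid_mono h)
      top_mono := fun a b h hab =>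
        g.top_mono _ _ (by rw [f.comm, f.comm, h]) (f.top_mono a b h hab) }

@[ext]
theorem hom_ext {S T : PrunedTree} {f g : S ⟶ T} (h₁ : ∀ a, Hom.top f a = Hom.top g a)
    (h₂ : ∀ x, Hom.mid f x = Hom.mid g x) : f = g :=
  Hom.ext (funext h₁) (funext h₂)

@[simp] theorem id_top (S : PrunedTree) (a : S.Top) : Hom.top (𝟙 S) a = a := rfl
@[simp] theorem id_mid (S : PrunedTree) (x : S.Mid) : Hom.mid (𝟙 S) x = x := rfl
@[simp] theorem comp_top {S T U : PrunedTree} (f : S ⟶ T) (g : T ⟶ U) (a : S.Top) :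
    Hom.top (f ≫ g) a = Hom.top g (Hom.top f a) := rfl
@[simp] theorem comp_mid {S T U : PrunedTree} (f : S ⟶ T) (g : T ⟶ U) (x : S.Mid) :
    Hom.mid (f ≫ g) x = Hom.mid g (Hom.mid f x) := rfl

/-! ### The monoidal structure given by ordered sums -/

/-- The map of ordered sums induced by a pair of maps. -/
def sumMap {α β γ δ : Type} (f : α → γ) (g : β → δ) (a : α ⊕ₗ β) : γ ⊕ₗ δ :=
  toLex (Sum.map f g (ofLex a))

theorem sumMap_mono {α β γ δ : Type} [LinearOrder α] [LinearOrder β] [LinearOrder γ]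
    [LinearOrder δ] {f : α → γ} {g : β → δ} (hf : Monotone f) (hg : Monotone g) :
    Monotone (sumMap f g) := by
  rintro (a | a) (b | b) h
  · exact Sum.Lex.inl_le_inl_iff.2 (hf (Sum.Lex.inl_le_inl_iff.1 h))
  · exact Sum.Lex.inl_le_inr _ _
  · exact absurd h Sum.Lex.not_inr_le_inl
  · exact Sum.Lex.inr_le_inr_iff.2 (hg (Sum.Lex.inr_le_inr_iff.1 h))

/-- The reassociation map of ordered sums. -/
def sumAssoc {α β γ : Type} (a : (α ⊕ₗ β) ⊕ₗ γ) : α ⊕ₗ (β ⊕ₗ γ) :=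
  match ofLex a with
  | Sum.inl x =>
    match ofLex x with
    | Sum.inl y => toLex (Sum.inl y)
    | Sum.inr y => toLex (Sum.inr (toLex (Sum.inl y)))
  | Sum.inr x => toLex (Sum.inr (toLex (Sum.inr x)))

/-- The inverse reassociation map of ordered sums. -/
def sumAssocInv {α β γ : Type} (a : α ⊕ₗ (β ⊕ₗ γ)) : (α ⊕ₗ β) ⊕ₗ γ :=
  match ofLex a with
  | Sum.inl x => toLex (Sum.inl (toLex (Sum.inl x)))
  | Sum.inr x =>
    match ofLex x with
    | Sum.inl y => toLex (Sum.inl (toLex (Sum.inr y)))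
    | Sum.inr y => toLex (Sum.inr y)

/-- Two maps out of the summands give a map out of the ordered sum. -/
def sumElim {α β γ : Type} (f : α → γ) (g : β → γ) (a : α ⊕ₗ β) : γ :=
  Sum.elim f g (ofLex a)

theorem sumAssoc_mono {α β γ : Type} [LinearOrder α] [LinearOrder β] [LinearOrder γ] :
    Monotone (sumAssoc (α := α) (β := β) (γ := γ)) := by
  rintro ((a | a) | a) ((b | b) | b) h
  · exact Sum.Lex.inl_le_inl_iff.2 (Sum.Lex.inl_le_inl_iff.1 (Sum.Lex.inl_le_inl_iff.1 h))
  · exact Sum.Lex.inl_le_inr _ _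
  · exact Sum.Lex.inl_le_inr _ _
  · exact absurd (Sum.Lex.inl_le_inl_iff.1 h) Sum.Lex.not_inr_le_inl
  · exact Sum.Lex.inr_le_inr_iff.2 (Sum.Lex.inl_le_inl_iff.2
      (Sum.Lex.inr_le_inr_iff.1 (Sum.Lex.inl_le_inl_iff.1 h)))
  · exact Sum.Lex.inr_le_inr_iff.2 (Sum.Lex.inl_le_inr _ _)
  · exact absurd h Sum.Lex.not_inr_le_inl
  · exact absurd h Sum.Lex.not_inr_le_inl
  · exact Sum.Lex.inr_le_inr_iff.2 (Sum.Lex.inr_le_inr_iff.2 (Sum.Lex.inr_le_inr_iff.1 h))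

theorem sumAssocInv_mono {α β γ : Type} [LinearOrder α] [LinearOrder β] [LinearOrder γ] :
    Monotone (sumAssocInv (α := α) (β := β) (γ := γ)) := by
  rintro (a | (a | a)) (b | (b | b)) h
  · exact Sum.Lex.inl_le_inl_iff.2 (Sum.Lex.inl_le_inl_iff.2 (Sum.Lex.inl_le_inl_iff.1 h))
  · exact Sum.Lex.inl_le_inl_iff.2 (Sum.Lex.inl_le_inr _ _)
  · exact Sum.Lex.inl_le_inr _ _
  · exact absurd h Sum.Lex.not_inr_le_inl
  · exact Sum.Lex.inl_le_inl_iff.2 (Sum.Lex.inr_le_inr_iff.2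
      (Sum.Lex.inl_le_inl_iff.1 (Sum.Lex.inr_le_inr_iff.1 h)))
  · exact Sum.Lex.inl_le_inr _ _
  · exact absurd h Sum.Lex.not_inr_le_inl
  · exact absurd (Sum.Lex.inr_le_inr_iff.1 h) Sum.Lex.not_inr_le_inl
  · exact Sum.Lex.inr_le_inr_iff.2 (Sum.Lex.inr_le_inr_iff.1 (Sum.Lex.inr_le_inr_iff.1 h))

/-- The ordered sum of two trees. -/
def tensor (S T : PrunedTree) : PrunedTree where
  Top := S.Top ⊕ₗ T.Top
  Mid := S.Mid ⊕ₗ T.Mid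
  topFinite := inferInstanceAs (Finite (S.Top ⊕ T.Top))
  midFinite := inferInstanceAs (Finite (S.Mid ⊕ T.Mid))
  proj := sumMap S.proj T.proj
  surj := by
    rintro (x | x)
    · obtain ⟨a, rfl⟩ := S.surj x
      exact ⟨toLex (Sum.inl a), rfl⟩
    · obtain ⟨a, rfl⟩ := T.surj x
      exact ⟨toLex (Sum.inr a), rfl⟩

/-- The ordered sum of two maps of trees. -/
def tensorMap {S S' T T' : PrunedTree} (f : S ⟶ S') (g : T ⟶ T') :
    tensor S T ⟶ tensor S' T' where
  top := sumMap (Hom.top f) (Hom.top g)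
  mid := sumMap (Hom.mid f) (Hom.mid g)
  comm := by
    rintro (a | a)
    · exact congrArg (fun z => toLex (Sum.inl z)) (Hom.comm f a)
    · exact congrArg (fun z => toLex (Sum.inr z)) (Hom.comm g a)
  mid_mono := sumMap_mono (Hom.mid_mono f) (Hom.mid_mono g)
  top_mono := by
    rintro (a | a) (b | b) h hab
    · exact Sum.Lex.inl_le_inl_iff.2 (Hom.top_mono f a b
        (Sum.inl_injective (toLex.injective h)) (Sum.Lex.inl_le_inl_iff.1 hab))
    · exact Sum.Lex.inl_le_inr _ _
    · exact absurd hab Sum.Lex.not_inr_le_inl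
    · exact Sum.Lex.inr_le_inr_iff.2 (Hom.top_mono g a b
        (Sum.inr_injective (toLex.injective h)) (Sum.Lex.inr_le_inr_iff.1 hab))

/-- The empty tree. -/
def unit : PrunedTree where
  Top := Empty
  Mid := Empty
  proj := fun a => a
  surj := fun a => ⟨a, rfl⟩

/-- The associativity isomorphism of ordered sums. -/
def assocIso (S T U : PrunedTree) : tensor (tensor S T) U ≅ tensor S (tensor T U) where
  hom :=
    { top := sumAssoc
      mid := sumAssoc
      comm := by rintro ((a | a) | a) <;> rfl
      mid_mono := sumAssoc_mono
      top_mono := fun _ _ _ h => sumAssoc_mono h }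
  inv :=
    { top := sumAssocInv
      mid := sumAssocInv
      comm := by rintro (a | (a | a)) <;> rfl
      mid_mono := sumAssocInv_mono
      top_mono := fun _ _ _ h => sumAssocInv_mono h }
  hom_inv_id := by
    apply hom_ext <;> rintro ((a | a) | a) <;> rfl
  inv_hom_id := by
    apply hom_ext <;> rintro (a | (a | a)) <;> rfl

/-- The left unit isomorphism of ordered sums. -/
def leftUnitIso (S : PrunedTree) : tensor unit S ≅ S where
  hom :=
    { top := sumElim Empty.elim fun a => a
      mid := sumElim Empty.elim fun a => a
      comm := by
        rintro (a | a)
        · exact a.elim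
        · rfl
      mid_mono := by
        rintro (a | a) (b | b) h
        · exact a.elim
        · exact a.elim
        · exact b.elim
        · exact Sum.Lex.inr_le_inr_iff.1 h
      top_mono := by
        rintro (a | a) (b | b) _ h
        · exact a.elim
        · exact a.elim
        · exact b.elim
        · exact Sum.Lex.inr_le_inr_iff.1 h }
  inv :=
    { top := fun a => toLex (Sum.inr a)
      mid := fun a => toLex (Sum.inr a)
      comm := fun _ => rfl
      mid_mono := fun _ _ h => Sum.Lex.inr_le_inr_iff.2 h
      top_mono := fun _ _ _ h => Sum.Lex.inr_le_inr_iff.2 h }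
  hom_inv_id := by
    apply hom_ext <;> rintro (a | a) <;> first | exact a.elim | rfl
  inv_hom_id := rfl

/-- The right unit isomorphism of ordered sums. -/
def rightUnitIso (S : PrunedTree) : tensor S unit ≅ S where
  hom :=
    { top := sumElim (fun a => a) Empty.elim
      mid := sumElim (fun a => a) Empty.elim
      comm := by
        rintro (a | a)
        · rfl
        · exact a.elim
      mid_mono := by
        rintro (a | a) (b | b) h
        · exact Sum.Lex.inl_le_inl_iff.1 h
        · exact b.elim
        · exact a.elim
        · exact a.elim
      top_mono := by
        rintro (a | a) (b | b) _ h
        · exact Sum.Lex.inl_le_inl_iff.1 h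
        · exact b.elim
        · exact a.elim
        · exact a.elim }
  inv :=
    { top := fun a => toLex (Sum.inl a)
      mid := fun a => toLex (Sum.inl a)
      comm := fun _ => rfl
      mid_mono := fun _ _ h => Sum.Lex.inl_le_inl_iff.2 h
      top_mono := fun _ _ _ h => Sum.Lex.inl_le_inl_iff.2 h }
  hom_inv_id := by
    apply hom_ext <;> rintro (a | a) <;> first | exact a.elim | rfl
  inv_hom_id := rfl

instance : MonoidalCategoryStruct PrunedTree where
  tensorObj := tensor
  whiskerLeft S _ _ f := tensorMap (𝟙 S) f
  whiskerRight f T := tensorMap f (𝟙 T)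
  tensorHom f g := tensorMap f g
  tensorUnit := unit
  associator := assocIso
  leftUnitor := leftUnitIso
  rightUnitor := rightUnitIso

instance : MonoidalCategory PrunedTree :=
  MonoidalCategory.ofTensorHom
    (id_tensorHom_id := fun _ _ => by
      apply hom_ext <;> rintro (a | a) <;> rfl)
    (id_tensorHom := fun _ _ _ _ => rfl)
    (tensorHom_id := fun _ _ => rfl)
    (tensorHom_comp_tensorHom := fun _ _ _ _ => by
      apply hom_ext <;> rintro (a | a) <;> rfl)
    (associator_naturality := fun _ _ _ => by
      apply hom_ext <;> rintro ((a | a) | a) <;> rfl)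
    (leftUnitor_naturality := fun _ => by
      apply hom_ext <;> rintro (a | a) <;> first | exact a.elim | rfl)
    (rightUnitor_naturality := fun _ => by
      apply hom_ext <;> rintro (a | a) <;> first | exact a.elim | rfl)
    (pentagon := fun _ _ _ _ => by
      apply hom_ext <;> rintro (((a | a) | a) | a) <;> rfl)
    (triangle := fun _ _ => by
      apply hom_ext <;> rintro ((a | a) | a) <;> first | exact a.elim | rfl)

/-! ### The cosimplicial monoid of corollas -/

/-- The tree `X → [1]` on a nonempty finite ordered set `X`. -/
def corolla (X : SimplexCategory) : PrunedTree where
  Top := Fin (X.len + 1)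
  Mid := Unit
  proj := fun _ => ()
  surj := fun _ => ⟨0, rfl⟩

/-- The multiplication is the codiagonal on leaves and the unit is the inclusion of the empty
tree. -/
instance corollaMonObj (X : SimplexCategory) : MonObj (corolla X) where
  one :=
    { top := Empty.elim
      mid := Empty.elim
      comm := fun a => a.elim
      mid_mono := fun a => a.elim
      top_mono := fun a => a.elim }
  mul :=
    { top := sumElim (fun a => a) (fun a => a)
      mid := fun _ => ()
      comm := fun _ => rfl
      mid_mono := fun _ _ _ => le_rfl
      top_mono := by
        rintro (a | a) (b | b) h hab
        · exact Sum.Lex.inl_le_inl_iff.1 hab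
        · exact absurd (toLex.injective h) Sum.inl_ne_inr
        · exact absurd (toLex.injective h) Sum.inr_ne_inl
        · exact Sum.Lex.inr_le_inr_iff.1 hab }
  one_mul := by
    apply hom_ext <;> rintro (a | a) <;> first | exact a.elim | rfl
  mul_one := by
    apply hom_ext <;> rintro (a | a) <;> first | exact a.elim | rfl
  mul_assoc := by
    apply hom_ext <;> rintro ((a | a) | a) <;> rfl

/-- The map of corollas induced by an order-preserving map. -/
def corollaMap {X Y : SimplexCategory} (f : X ⟶ Y) : corolla X ⟶ corolla Y where
  top := fun a => f.toOrderHom a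
  mid := fun x => x
  comm := fun _ => rfl
  mid_mono := fun _ _ h => h
  top_mono := fun _ _ _ h => f.toOrderHom.monotone h

instance corollaMap_isMonHom {X Y : SimplexCategory} (f : X ⟶ Y) : IsMonHom (corollaMap f) where
  one_hom := by
    apply hom_ext <;> intro a <;> exact a.elim
  mul_hom := by
    apply hom_ext <;> rintro (a | a) <;> rfl

/-- The cosimplicial monoid `S^*` in the category of pruned trees of height two. -/
def corollas : CosimplicialObject (Mon PrunedTree) :=
  { obj := fun X => Mon.mk (corolla X)
    map := fun f => Mon.Hom.mk (corollaMap f)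
    map_id := fun _ => rfl
    map_comp := fun _ _ => rfl : SimplexCategory ⥤ Mon PrunedTree }

end PrunedTree

/-! ### Strong monoidal functors and evaluation -/

/-- A (strong) monoidal functor, bundled. -/
structure StrongMonoidalFunctor (C : Type u) [Category.{v} C] [MonoidalCategory C]
    (D : Type u') [Category.{v'} D] [MonoidalCategory D] where
  functor : C ⥤ D
  [monoidal : functor.Monoidal]

namespace StrongMonoidalFunctor

attribute [instance] monoidal

variable {C : Type u} [Category.{v} C] [MonoidalCategory C]
  {D : Type u'} [Category.{v'} D] [MonoidalCategory D]

/-- A monoidal natural transformation. -/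
@[ext]
structure Hom (F G : StrongMonoidalFunctor C D) where
  hom : F.functor ⟶ G.functor
  [isMonoidal : NatTrans.IsMonoidal hom]

attribute [instance] Hom.isMonoidal

instance : Category (StrongMonoidalFunctor C D) where
  Hom := Hom
  id F := { hom := 𝟙 F.functor }
  comp f g := { hom := f.hom ≫ g.hom }

end StrongMonoidalFunctor

/-- Evaluation at the cosimplicial monoid of corollas: a monoidal functor `F` goes to the
cosimplicial monoid `[n] ↦ F (S^n)`, and a monoidal natural transformation goes to the family of
its components at the corollas. -/
def evaluationAtCorollas (C : Type u) [Category.{v} C] [MonoidalCategory C] :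
    StrongMonoidalFunctor PrunedTree C ⥤ CosimplicialObject (Mon C) where
  obj F := Functor.comp (PrunedTree.corollas : SimplexCategory ⥤ Mon PrunedTree) F.functor.mapMon
  map f := Functor.whiskerLeft (PrunedTree.corollas : SimplexCategory ⥤ Mon PrunedTree)
    (Functor.mapMonNatTrans (StrongMonoidalFunctor.Hom.hom f))
  map_id _ := rfl
  map_comp _ _ := rfl

/-! A word of ordinals stands for an ordered sum of corollas. Maps of trees need be monotone only on
vertices of height one and inside fibres, so a map between two such sums is a monotone map of the
vertices of height one together with, for each corolla of the source, an unrelated monotone map to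
the corolla it lands in. This is exactly what units, multiplications and cosimplicial maps produce,
and it has a unique normal form read from the left: either the first target letter receives nothing
more and is filled by a unit (`skip`), or the first source letter is multiplied into it (`push`).
Hence `ofWord` is faithful and full (`evalMap_corollaMon_injective`,
`evalMap_corollaMon_surjective`). Since the order between leaves of different fibres is irrelevant
up to isomorphism, every tree is a sum of corollas (`exists_iso_corolla_tensor`), and `ofWord` is an
equivalence.

Normal forms can be interpreted in any monoidal category along a diagram of monoids, and the monoid
axioms are what the composition rules require (`evalMap_comp`). The resulting strong monoidal
functor `eval M`, preceded by an inverse of `ofWord`, realises a given cosimplicial monoid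
(`exists_evaluation_iso`). A monoidal transformation is determined by its values on tensor factors
(`natTrans_ext`). Conversely, a map of cosimplicial monoids extends to words by tensoring its
components, and naturality is checked on `skip` and `push` only (`exists_extension`). -/

/-! ### Words of monoids -/

/-- The objects of the free monoidal category on an `A`-indexed diagram of monoids: the word
`[x₁, …, xₙ]` stands for the tensor product of the monoids indexed by the `xᵢ`. -/
def MonWord (A : Type u) : Type u := List A

namespace MonWord

variable {A : Type u} [Category.{v} A]

/-- Normal forms of the morphisms of words. -/
inductive Hom : List A → List A → Type max u v
  | nil : Hom [] []
  /-- insert the unit of the first monoid of the target -/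
  | skip (y : A) {L M : List A} (f : Hom L M) : Hom L (y :: M)
  /-- multiply the first letter of the source into the first letter of the target -/
  | push {x y : A} {L M : List A} (a : x ⟶ y) (f : Hom L (y :: M)) : Hom (x :: L) (y :: M)

namespace Hom

/-- A map of words extended by the identity on a new first letter. -/
def cons (x : A) {L M : List A} (f : Hom L M) : Hom (x :: L) (x :: M) :=
  push (𝟙 x) (skip x f)

/-- The identity map of a word. -/
def id : (L : List A) → Hom L L
  | [] => nil
  | x :: L => cons x (id L)

/-- Composition of maps of words. -/
def comp : {L M N : List A} → Hom L M → Hom M N → Hom L N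
  | _, _, _, nil, g => g
  | _, _, _, skip y f, skip z g => skip z (comp (skip y f) g)
  | _, _, _, push a f, skip z g => skip z (comp (push a f) g)
  -- A unit that is inserted and then multiplied in disappears.
  | _, _, _, skip _ f, push _ g => comp f g
  -- The target letter stays open after a `push`, so the remaining source letters still have to meet
  -- the same `push b g`.
  | _, _, _, push a f, push b g => push (a ≫ b) (comp f (push b g))
termination_by _ _ _ f g => sizeOf f + sizeOf g

@[simp] theorem nil_comp {N : List A} (g : Hom [] N) : comp nil g = g := by rw [comp]

@[simp] theorem comp_skip {L M N : List A} (f : Hom L M) (z : A) (g : Hom M N) :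
    comp f (skip z g) = skip z (comp f g) := by
  cases f <;> simp [comp]

@[simp] theorem skip_comp_push {L M N : List A} {y z : A} (f : Hom L M) (b : y ⟶ z)
    (g : Hom M (z :: N)) : comp (skip y f) (push b g) = comp f g := by rw [comp]

@[simp] theorem push_comp_push {L M N : List A} {x y z : A} (a : x ⟶ y) (f : Hom L (y :: M))
    (b : y ⟶ z) (g : Hom M (z :: N)) :
    comp (push a f) (push b g) = push (a ≫ b) (comp f (push b g)) := by rw [comp]

@[simp] theorem comp_id {L M : List A} (f : Hom L M) : comp f (id M) = f := by
  induction f with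
  | nil => simp [id]
  | skip y f ih => simp [id, cons, ih]
  | push a f ih =>
    rw [id, cons] at ih ⊢
    simp [ih]

@[simp] theorem id_comp {L M : List A} (f : Hom L M) : comp (id L) f = f := by
  induction f with
  | nil => simp [id]
  | skip y f ih => simp [ih]
  | push a f ih => simp [id, cons, ih]

theorem cons_comp_cons (x : A) {L M N : List A} (f : Hom L M) (g : Hom M N) :
    comp (cons x f) (cons x g) = cons x (comp f g) := by
  simp [cons]

/-- The last map is analysed first: its `skip`s slide out of both sides, and a leading `push`
consumes the head of the middle map, then that of the first. -/
theorem assoc : {L M N P : List A} → (f : Hom L M) → (g : Hom M N) → (h : Hom N P) →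
    comp (comp f g) h = comp f (comp g h)
  | _, _, _, _, f, g, skip z h => by simp [assoc f g h]
  | _, _, _, _, f, g, nil => by
    cases g
    simp only [nil_comp]
    cases f
    simp
  | _, _, _, _, f, skip y g, push c h => by simp [assoc f g h]
  | _, _, _, _, skip x f, push b g, push c h => by simp [assoc f g (push c h)]
  | _, _, _, _, push a f, push b g, push c h => by
    simpa using assoc f (push b g) (push c h)
termination_by _ _ _ _ f g h => sizeOf f + sizeOf g + sizeOf h

/-- The tensor product of a map of words with an identity on the right. -/
def whiskerRight : {L M : List A} → Hom L M → (N : List A) → Hom (L ++ N) (M ++ N)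
  | _, _, nil, N => id N
  | _, _, skip y f, N => skip y (whiskerRight f N)
  | _, _, push a f, N => push a (whiskerRight f N)

/-- The tensor product of a map of words with an identity on the left. -/
def whiskerLeft : (N : List A) → {L M : List A} → Hom L M → Hom (N ++ L) (N ++ M)
  | [], _, _, f => f
  | x :: N, _, _, f => cons x (whiskerLeft N f)

end Hom

instance : Category (MonWord A) where
  Hom L M := Hom L M
  id L := Hom.id L
  comp f g := Hom.comp f g
  id_comp f := Hom.id_comp f
  comp_id f := Hom.comp_id f
  assoc f g h := Hom.assoc f g h

/-- A map of words extended by the identity on a new first letter, as a functor. -/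
def consFunctor (x : A) : MonWord A ⥤ MonWord A where
  obj L := List.cons x L
  map f := Hom.cons x f
  map_id _ := rfl
  map_comp f g := (Hom.cons_comp_cons x f g).symm

/-- The associator of words. -/
def assocIso : (L M N : List A) →
    ((show MonWord A from (L ++ M) ++ N) ≅ (show MonWord A from L ++ (M ++ N)))
  | [], _, _ => Iso.refl _
  | x :: L, M, N => (consFunctor x).mapIso (assocIso L M N)

/-- The right unitor of words. -/
def rightUnitIso : (L : List A) → ((show MonWord A from L ++ []) ≅ (show MonWord A from L))
  | [] => Iso.refl _
  | x :: L => (consFunctor x).mapIso (rightUnitIso L)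

instance : MonoidalCategoryStruct (MonWord A) where
  tensorObj L M := List.append L M
  whiskerLeft L _ _ f := Hom.whiskerLeft L f
  whiskerRight f L := Hom.whiskerRight f L
  tensorUnit := ([] : List A)
  associator := assocIso
  leftUnitor L := Iso.refl L
  rightUnitor := rightUnitIso

end MonWord

/-! ### The free module on a monoid -/

namespace FreeMod

open scoped MonObj

variable {C : Type u} [Category.{v} C] [MonoidalCategory C]

/-- Insertion of the unit of a monoid on the left. -/
def unit (Y : C) [MonObj Y] (X : C) : X ⟶ Y ⊗ X := (λ_ X).inv ≫ η[Y] ▷ X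

/-- The left multiplication of a monoid `Y` on `Y ⊗ X`. -/
def act (Y : C) [MonObj Y] (X : C) : Y ⊗ (Y ⊗ X) ⟶ Y ⊗ X := (α_ Y Y X).inv ≫ μ[Y] ▷ X

variable (Y : C) [MonObj Y]

/-- Together with the next four identities, this says that `Y ⊗ -` is a monad with unit `unit` and
multiplication `act`. -/
theorem unit_naturality {X X' : C} (f : X ⟶ X') : f ≫ unit Y X' = unit Y X ≫ Y ◁ f := by
  simp only [unit, Category.assoc]
  rw [← whisker_exchange]
  simp

theorem act_naturality {X X' : C} (f : X ⟶ X') :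
    Y ◁ (Y ◁ f) ≫ act Y X' = act Y X ≫ Y ◁ f := by
  simp only [act, Category.assoc]
  rw [← whisker_exchange]
  simp

theorem unit_act (X : C) : unit Y (Y ⊗ X) ≫ act Y X = 𝟙 _ := by
  have : η[Y] ▷ (Y ⊗ X) = (α_ _ _ _).inv ≫ η[Y] ▷ Y ▷ X ≫ (α_ _ _ _).hom := by simp
  simp only [unit, act, Category.assoc, this, Iso.hom_inv_id_assoc]
  rw [← comp_whiskerRight, MonObj.one_mul]
  simp

theorem whiskerLeft_unit_act (X : C) : Y ◁ unit Y X ≫ act Y X = 𝟙 _ := by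
  have : Y ◁ η[Y] ▷ X = (α_ _ _ _).inv ≫ (Y ◁ η[Y]) ▷ X ≫ (α_ _ _ _).hom := by simp
  simp only [unit, act, Category.assoc, whiskerLeft_comp, this, Iso.hom_inv_id_assoc]
  rw [← comp_whiskerRight, MonObj.mul_one]
  simp

theorem act_act (X : C) : act Y (Y ⊗ X) ≫ act Y X = Y ◁ act Y X ≫ act Y X := by
  have : μ[Y] ▷ (Y ⊗ X) = (α_ _ _ _).inv ≫ μ[Y] ▷ Y ▷ X ≫ (α_ _ _ _).hom := by simp
  have h' : Y ◁ μ[Y] ▷ X = (α_ _ _ _).inv ≫ (Y ◁ μ[Y]) ▷ X ≫ (α_ _ _ _).hom := by simp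
  simp only [act, Category.assoc, whiskerLeft_comp, this, h', Iso.hom_inv_id_assoc]
  rw [← comp_whiskerRight, ← comp_whiskerRight, MonObj.mul_assoc]
  simp

variable {Y} {Z : C} [MonObj Z] (a : Y ⟶ Z) [IsMonHom a]

/-- With `act_map`: a homomorphism of monoids induces a morphism of the associated monads. -/
theorem unit_map (X : C) : unit Y X ≫ a ▷ X = unit Z X := by
  simp [unit, ← comp_whiskerRight]

theorem act_map (X : C) : act Y X ≫ a ▷ X = Y ◁ a ▷ X ≫ a ▷ (Z ⊗ X) ≫ act Z X := by
  simp only [act, Category.assoc, ← comp_whiskerRight, IsMonHom.mul_hom]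
  simp [tensorHom_def']

/-- The map `Y ⊗ X ⟶ Z ⊗ X'` which applies `a : Y ⟶ Z` and `f : X ⟶ Z ⊗ X'` and multiplies. -/
def push {Y Z : C} [MonObj Z] (a : Y ⟶ Z) {X X' : C} (f : X ⟶ Z ⊗ X') : Y ⊗ X ⟶ Z ⊗ X' :=
  Y ◁ f ≫ a ▷ (Z ⊗ X') ≫ act Z X'

theorem push_id_unit {X X' : C} (f : X ⟶ X') : push (𝟙 Y) (f ≫ unit Y X') = Y ◁ f := by
  simp [push, whiskerLeft_unit_act]

/-- The counterpart of `Hom.skip_comp_push`; it rests on the left unit law. -/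
theorem unit_push {W X X' : C} (f : W ⟶ X) (g : X ⟶ Z ⊗ X') :
    (f ≫ unit Y X) ≫ push a g = f ≫ g := by
  rw [push, Category.assoc, ← reassoc_of% @unit_naturality, reassoc_of% @unit_map, unit_act,
    Category.comp_id]

/-- The counterpart of `Hom.push_comp_push`; it rests on associativity and on `a` being
multiplicative. -/
theorem push_push {W : C} (b : W ⟶ Y) {X X' X'' : C} (f : X ⟶ Y ⊗ X') (g : X' ⟶ Z ⊗ X'') :
    push b f ≫ push a g = push (b ≫ a) (f ≫ push a g) := by
  simp only [push, Category.assoc, whiskerLeft_comp, comp_whiskerRight]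
  rw [← reassoc_of% @act_naturality, reassoc_of% @act_map, act_act]
  simp only [← whisker_exchange_assoc]

theorem push_comp_whiskerLeft {W : C} (b : W ⟶ Y) {X X' X'' : C} (f : X ⟶ Y ⊗ X')
    (g : X' ⟶ X'') : push b f ≫ Y ◁ g = push b (f ≫ Y ◁ g) := by
  simp only [push, Category.assoc, whiskerLeft_comp, ← act_naturality]
  rw [← whisker_exchange_assoc]

theorem whiskerLeft_comp_push {W : C} (b : W ⟶ Y) {X X' X'' : C} (f : X ⟶ X')
    (g : X' ⟶ Y ⊗ X'') : W ◁ f ≫ push b g = push b (f ≫ g) := by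
  simp [push]

theorem unit_whiskerRight (X X' : C) :
    unit Y X ▷ X' ≫ (α_ Y X X').hom = unit Y (X ⊗ X') := by
  simp [unit]

theorem act_whiskerRight (X X' : C) :
    act Y X ▷ X' ≫ (α_ Y X X').hom =
      (α_ Y (Y ⊗ X) X').hom ≫ Y ◁ (α_ Y X X').hom ≫ act Y (X ⊗ X') := by
  simp [act]

theorem push_whiskerRight {W : C} (b : W ⟶ Y) {X X' : C} (f : X ⟶ Y ⊗ X') (P : C) :
    push b f ▷ P ≫ (α_ Y X' P).hom =
      (α_ W X P).hom ≫ push b (f ▷ P ≫ (α_ Y X' P).hom) := by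
  simp only [push, comp_whiskerRight, Category.assoc, act_whiskerRight, whiskerLeft_comp]
  simp

/-! Commutative squares for the inductive arguments about the interpretation of words. -/

theorem unit_whiskerRight_square {X X' P R R' : C} (f : X ⟶ X') (e : X ⊗ P ⟶ R) (e' : X' ⊗ P ⟶ R')
    (g : R ⟶ R') (h : f ▷ P ≫ e' = e ≫ g) :
    (f ≫ unit Y X') ▷ P ≫ (α_ Y X' P).hom ≫ Y ◁ e' = e ≫ g ≫ unit Y R' := by
  rw [← reassoc_of% h, comp_whiskerRight, Category.assoc, ← Category.assoc (unit Y X' ▷ P),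
    unit_whiskerRight, unit_naturality]

theorem push_whiskerRight_square {W : C} (b : W ⟶ Y) {X X' P R R' : C} (f : X ⟶ Y ⊗ X')
    (e : X ⊗ P ⟶ R) (e' : X' ⊗ P ⟶ R') (g : R ⟶ Y ⊗ R')
    (h : f ▷ P ≫ (α_ Y X' P).hom ≫ Y ◁ e' = e ≫ g) :
    push b f ▷ P ≫ (α_ Y X' P).hom ≫ Y ◁ e' = ((α_ W X P).hom ≫ W ◁ e) ≫ push b g := by
  rw [← Category.assoc, push_whiskerRight, Category.assoc, push_comp_whiskerLeft, Category.assoc, h,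
    Category.assoc, whiskerLeft_comp_push]

omit [MonObj Y] in
theorem whiskerLeft_square {N X X' R R' : C} (f : X ⟶ X') (e : N ⊗ X ⟶ R) (e' : N ⊗ X' ⟶ R')
    (g : R ⟶ R') (h : N ◁ f ≫ e' = e ≫ g) :
    (Y ⊗ N) ◁ f ≫ (α_ Y N X').hom ≫ Y ◁ e' = ((α_ Y N X).hom ≫ Y ◁ e) ≫ Y ◁ g := by
  rw [Category.assoc, ← whiskerLeft_comp, ← h]
  simp

theorem associativity_unit_square {X X' R : C} (e : X ⊗ X' ⟶ R) :
    (λ_ X).hom ▷ X' ≫ e ≫ 𝟙 R = (α_ (𝟙_ C) X X').hom ≫ 𝟙_ C ◁ e ≫ (λ_ R).hom := by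
  simp

omit [MonObj Y] in
theorem associativity_square {X X' X'' R R' Q T : C} (e : X ⊗ X' ⟶ R) (e' : R ⊗ X'' ⟶ R')
    (a : R' ⟶ T) (d : X' ⊗ X'' ⟶ Q) (d' : X ⊗ Q ⟶ T)
    (h : e ▷ X'' ≫ e' ≫ a = (α_ X X' X'').hom ≫ X ◁ d ≫ d') :
    ((α_ Y X X').hom ≫ Y ◁ e) ▷ X'' ≫ ((α_ Y R X'').hom ≫ Y ◁ e') ≫ Y ◁ a =
      (α_ (Y ⊗ X) X' X'').hom ≫ (Y ⊗ X) ◁ d ≫ (α_ Y X Q).hom ≫ Y ◁ d' := by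
  have : Y ◁ e ▷ X'' ≫ Y ◁ e' ≫ Y ◁ a =
      Y ◁ (α_ X X' X'').hom ≫ Y ◁ X ◁ d ≫ Y ◁ d' := by
    simpa using congrArg (Y ◁ ·) h
  simp [this]

end FreeMod

namespace MonWord

variable {A : Type u'} [Category.{v'} A] {C : Type u} [Category.{v} C] [MonoidalCategory C]

/-! ### The interpretation of words -/

section Interpretation

variable (M : A ⥤ Mon C)

/-- The tensor product indexed by a word. -/
def evalObj : List A → C
  | [] => 𝟙_ C
  | x :: L => (M.obj x).X ⊗ evalObj L

/-- The interpretation of the maps of words. -/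
def evalMap : {L L' : List A} → Hom L L' → (evalObj M L ⟶ evalObj M L')
  | _, _, .nil => 𝟙 _
  | _, _, .skip y f => evalMap f ≫ FreeMod.unit (M.obj y).X _
  | _, _, .push a f => FreeMod.push (M.map a).hom (evalMap f)

theorem evalMap_nil : evalMap M Hom.nil = 𝟙 _ := rfl

theorem evalMap_skip (y : A) {L L' : List A} (f : Hom L L') :
    evalMap M (Hom.skip y f) = evalMap M f ≫ FreeMod.unit (M.obj y).X (evalObj M L') := rfl

theorem evalMap_push {x y : A} (a : x ⟶ y) {L L' : List A} (f : Hom L (y :: L')) :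
    evalMap M (Hom.push a f) = FreeMod.push (M.map a).hom (evalMap M f) := rfl

theorem evalMap_cons (x : A) {L L' : List A} (f : Hom L L') :
    evalMap M (Hom.cons x f) = (M.obj x).X ◁ evalMap M f := by
  rw [Hom.cons, evalMap_push, M.map_id]
  exact FreeMod.push_id_unit (evalMap M f)

theorem evalMap_id (L : List A) : evalMap M (Hom.id L) = 𝟙 (evalObj M L) := by
  induction L with
  | nil => rfl
  | cons x L ih => rw [Hom.id, evalMap_cons, ih, whiskerLeft_id]; rfl

/-- Each composition rule of normal forms matches an identity of free modules: `unit_push` cancels a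
unit and `push_push` merges multiplications. -/
theorem evalMap_comp : {L L' L'' : List A} → (f : Hom L L') → (g : Hom L' L'') →
    evalMap M (Hom.comp f g) = evalMap M f ≫ evalMap M g
  | _, _, _, f, .skip z g => by
    rw [Hom.comp_skip, evalMap_skip, evalMap_skip, evalMap_comp f g]
    exact Category.assoc _ _ _
  | _, _, _, f, .nil => by
    cases f
    simp [evalMap_nil]
  | _, _, _, .skip y f, .push b g => by
    rw [Hom.skip_comp_push, evalMap_comp f g]
    exact (FreeMod.unit_push (M.map b).hom (evalMap M f) (evalMap M g)).symm
  | _, _, _, .push a f, .push b g => by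
    rw [Hom.push_comp_push, evalMap_push, evalMap_comp f (.push b g), M.map_comp]
    exact (FreeMod.push_push (M.map b).hom (M.map a).hom (evalMap M f) (evalMap M g)).symm
termination_by _ _ _ f g => sizeOf f + sizeOf g

/-- The functor interpreting words as tensor products. -/
@[simps]
def eval : MonWord A ⥤ C where
  obj := evalObj M
  map f := evalMap M f
  map_id := evalMap_id M
  map_comp := evalMap_comp M

/-- The interpretation of a concatenation. -/
def evalTensorIso : (L L' : List A) → (evalObj M L ⊗ evalObj M L' ≅ evalObj M (L ++ L'))
  | [], L' => λ_ (evalObj M L')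
  | x :: L, L' => α_ _ _ _ ≪≫ whiskerLeftIso (M.obj x).X (evalTensorIso L L')

theorem evalTensorIso_naturality_left {L L' : List A} (f : Hom L L') (N : List A) :
    evalMap M f ▷ evalObj M N ≫ (evalTensorIso M L' N).hom =
      (evalTensorIso M L N).hom ≫ evalMap M (Hom.whiskerRight f N) := by
  induction f with
  | nil =>
    have : evalMap M (Hom.whiskerRight Hom.nil N) = 𝟙 _ := evalMap_id M N
    rw [this, evalMap_nil, id_whiskerRight]
    exact (Category.id_comp _).trans (Category.comp_id _).symm
  | skip y f ih => exact FreeMod.unit_whiskerRight_square (evalMap M f) _ _ _ ih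
  | push a f ih => exact FreeMod.push_whiskerRight_square (M.map a).hom (evalMap M f) _ _ _ ih

theorem evalTensorIso_naturality_right (N : List A) {L L' : List A} (f : Hom L L') :
    evalObj M N ◁ evalMap M f ≫ (evalTensorIso M N L').hom =
      (evalTensorIso M N L).hom ≫ evalMap M (Hom.whiskerLeft N f) := by
  induction N with
  | nil => exact leftUnitor_naturality _
  | cons x N ih =>
    rw [Hom.whiskerLeft, evalMap_cons]
    exact FreeMod.whiskerLeft_square (evalMap M f) _ _ _ ih

/-- Only the first word needs induction, because concatenation, the associator of words and
`evalTensorIso` all recurse on it. -/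
theorem evalTensorIso_associativity (L L' L'' : List A) :
    (evalTensorIso M L L').hom ▷ evalObj M L'' ≫ (evalTensorIso M (L ++ L') L'').hom ≫
        evalMap M (assocIso L L' L'').hom =
      (α_ _ _ _).hom ≫ evalObj M L ◁ (evalTensorIso M L' L'').hom ≫
        (evalTensorIso M L (L' ++ L'')).hom := by
  induction L with
  | nil =>
    have : evalMap M (assocIso [] L' L'').hom = 𝟙 _ := evalMap_id M _
    rw [this]
    exact FreeMod.associativity_unit_square _
  | cons x L ih =>
    refine Eq.trans ?_ (FreeMod.associativity_square _ _ _ _ _ ih)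
    congr 2
    exact evalMap_cons M x _

theorem evalTensorIso_rightUnit (L : List A) :
    (ρ_ (evalObj M L)).hom = (evalTensorIso M L []).hom ≫ evalMap M (rightUnitIso L).hom := by
  induction L with
  | nil =>
    have : evalMap M (rightUnitIso ([] : List A)).hom = 𝟙 _ := evalMap_id M _
    rw [this]
    exact unitors_equal.symm.trans (Category.comp_id _).symm
  | cons x L ih =>
    have : evalMap M (rightUnitIso (x :: L)).hom =
      (M.obj x).X ◁ evalMap M (rightUnitIso L).hom := evalMap_cons M x _
    rw [this]
    refine Eq.trans ?_ (Category.assoc _ _ _).symm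
    refine (rightUnitor_tensor_hom _ _).trans ?_
    rw [ih]
    exact congrArg _ (whiskerLeft_comp _ _ _)

end Interpretation

end MonWord

/-! ### Pruned trees as words of corollas -/

namespace PrunedTree

section Push

variable {X Y : SimplexCategory} (a : X ⟶ Y) {S T : PrunedTree} (f : S ⟶ corolla Y ⊗ T)

/-- On the second summand, `f` is followed by the insertion of an extra copy of the corolla on the
left; merging the two copies by the codiagonal leaves the value of `f` unchanged. -/
theorem push_top_inr (b : S.Top) :
    Hom.top (FreeMod.push (corollaMap a) f) (toLex (Sum.inr b)) = Hom.top f b := by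
  have : ∀ z : Fin (Y.len + 1) ⊕ₗ T.Top,
    sumMap (sumElim (fun a => a) (fun a => a)) (fun a => a)
      (sumAssocInv (toLex (Sum.inr z) : Fin (Y.len + 1) ⊕ₗ (Fin (Y.len + 1) ⊕ₗ T.Top))) = z := by
    rintro (z | z) <;> rfl
  exact this _

theorem push_mid_inr (m : S.Mid) :
    Hom.mid (FreeMod.push (corollaMap a) f) (toLex (Sum.inr m)) = Hom.mid f m := by
  have : ∀ z : Unit ⊕ₗ T.Mid,
    sumMap (fun _ => ()) (fun a => a)
      (sumAssocInv (toLex (Sum.inr z) : Unit ⊕ₗ (Unit ⊕ₗ T.Mid))) = z := by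
    rintro (z | z) <;> rfl
  exact this _

end Push

theorem comp_unit_injective {Y : SimplexCategory} {S T : PrunedTree} {f g : S ⟶ T}
    (h : f ≫ FreeMod.unit (corolla Y) T = g ≫ FreeMod.unit (corolla Y) T) : f = g := by
  ext a
  · exact Sum.inr_injective (toLex.injective (congrFun (congrArg Hom.top h) a))
  · exact Sum.inr_injective (toLex.injective (congrFun (congrArg Hom.mid h) a))

/-- The map `a` is recovered by restricting to the first corolla, and `f` by restricting to the
rest. -/
theorem push_injective {X Y : SimplexCategory} {a b : X ⟶ Y} {S T : PrunedTree}
    {f g : S ⟶ corolla Y ⊗ T}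
    (h : FreeMod.push (corollaMap a) f = FreeMod.push (corollaMap b) g) : a = b ∧ f = g := by
  constructor
  · ext i : 3
    exact Sum.inl_injective (toLex.injective (congrFun (congrArg Hom.top h) (toLex (Sum.inl i))))
  · ext z
    · rw [← push_top_inr a f, h, push_top_inr]
    · rw [← push_mid_inr a f, h, push_mid_inr]

/-- The two forms disagree on the height-one vertex of the first source corolla: only a `push` sends
it to the first target corolla. -/
theorem comp_unit_ne_push {X Y : SimplexCategory} {a : X ⟶ Y} {S T : PrunedTree}
    (f : corolla X ⊗ S ⟶ T) (g : S ⟶ corolla Y ⊗ T) :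
    f ≫ FreeMod.unit (corolla Y) T ≠ FreeMod.push (corollaMap a) g := fun h =>
  Sum.inr_ne_inl
    (toLex.injective (congrFun (congrArg Hom.mid h) (toLex (Sum.inl ()))))

/-- If no vertex of height one meets the first corolla, then by commutativity no leaf does either.
-/
theorem exists_eq_comp_unit {Y : SimplexCategory} {S T : PrunedTree} (f : S ⟶ corolla Y ⊗ T)
    (hf : ∀ m, ∃ n, Hom.mid f m = toLex (Sum.inr n)) :
    ∃ g : S ⟶ T, f = g ≫ FreeMod.unit (corolla Y) T := by
  have hf' : ∀ b, ∃ c, Hom.top f b = toLex (Sum.inr c) := by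
    intro b
    obtain ⟨n, hn⟩ := hf (S.proj b)
    have h := (Hom.comm f b).trans hn
    rcases h' : Hom.top f b with c | c
    · rw [h'] at h
      exact absurd (toLex.injective h) Sum.inl_ne_inr
    · exact ⟨c, rfl⟩
  choose m hm using hf
  choose t ht using hf'
  refine ⟨{ top := t, mid := m, comm := fun b => ?_, mid_mono := fun i j hij => ?_,
            top_mono := fun i j h hij => ?_ }, ?_⟩
  · have h := Hom.comm f b
    rw [ht, hm] at h
    exact Sum.inr_injective (toLex.injective h)
  · have h := Hom.mid_mono f hij
    rw [hm, hm] at h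
    exact Sum.Lex.inr_le_inr_iff.1 h
  · have h := Hom.top_mono f i j h hij
    rw [ht, ht] at h
    exact Sum.Lex.inr_le_inr_iff.1 h
  · ext b
    · exact ht b
    · exact hm b

theorem exists_eq_push {X Y : SimplexCategory} {S T : PrunedTree}
    (f : corolla X ⊗ S ⟶ corolla Y ⊗ T)
    (hf : Hom.mid f (toLex (Sum.inl ())) = toLex (Sum.inl ())) :
    ∃ (a : X ⟶ Y) (g : S ⟶ corolla Y ⊗ T), f = FreeMod.push (corollaMap a) g := by
  have hf' : ∀ i, ∃ j, Hom.top f (toLex (Sum.inl i)) = toLex (Sum.inl j) := by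
    intro b
    have h := (Hom.comm f (toLex (Sum.inl b))).trans hf
    rcases h' : Hom.top f (toLex (Sum.inl b)) with c | c
    · exact ⟨c, rfl⟩
    · rw [h'] at h
      exact absurd (toLex.injective h) Sum.inr_ne_inl
  choose t ht using hf'
  have hmono : Monotone t := by
    intro i j hij
    have h := Hom.top_mono f (toLex (Sum.inl i)) (toLex (Sum.inl j)) rfl
      (Sum.Lex.inl_le_inl_iff.2 hij)
    rw [ht, ht] at h
    exact Sum.Lex.inl_le_inl_iff.1 h
  let g : S ⟶ corolla Y ⊗ T :=
    { top := fun b => Hom.top f (toLex (Sum.inr b))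
      mid := fun m => Hom.mid f (toLex (Sum.inr m))
      comm := fun b => Hom.comm f (toLex (Sum.inr b))
      mid_mono := fun m n h => Hom.mid_mono f (Sum.Lex.inr_le_inr_iff.2 h)
      top_mono := fun b c h hbc => Hom.top_mono f _ _
        (congrArg (fun z => toLex (Sum.inr z)) h) (Sum.Lex.inr_le_inr_iff.2 hbc) }
  refine ⟨SimplexCategory.Hom.mk ⟨t, hmono⟩, g, ?_⟩
  apply hom_ext
  · rintro (i | b)
    · exact ht i
    · exact (push_top_inr _ g b).symm
  · rintro (i | m)
    · exact hf
    · exact (push_mid_inr (SimplexCategory.Hom.mk ⟨t, hmono⟩) g m).symm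

/-- A map of corollas and a tree either avoids the first corolla of the target or multiplies
the first corolla of the source into it. -/
theorem eq_comp_unit_or_eq_push {X Y : SimplexCategory} {S T : PrunedTree}
    (f : corolla X ⊗ S ⟶ corolla Y ⊗ T) :
    (∃ g, f = g ≫ FreeMod.unit (corolla Y) T) ∨
      ∃ (a : X ⟶ Y) (g : S ⟶ corolla Y ⊗ T), f = FreeMod.push (corollaMap a) g := by
  rcases h : Hom.mid f (toLex (Sum.inl ())) with i | n
  · exact Or.inr (exists_eq_push f h)
  · refine Or.inl (exists_eq_comp_unit f fun m => ?_)
    -- The first vertex of height one is the least, so once it lands beyond the first target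
    -- corolla, monotonicity forces all the others beyond it.
    have hm : Hom.mid f (toLex (Sum.inl ())) ≤ Hom.mid f m := by
      apply Hom.mid_mono f
      rcases m with m | m
      · exact le_rfl
      · exact Sum.Lex.inl_le_inr _ _
    rw [h] at hm
    rcases h' : Hom.mid f m with k | k
    · rw [h'] at hm
      exact absurd hm Sum.Lex.not_inr_le_inl
    · exact ⟨k, rfl⟩

/-- The cosimplicial monoid of corollas, as a functor. -/
def corollaMon : SimplexCategory ⥤ Mon PrunedTree := corollas

/-- The functor from words to trees. -/
def ofWord : MonWord SimplexCategory ⥤ PrunedTree := MonWord.eval corollaMon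

theorem evalMap_corollaMon_injective {L L' : List SimplexCategory} {f g : MonWord.Hom L L'}
    (h : MonWord.evalMap corollaMon f = MonWord.evalMap corollaMon g) : f = g := by
  induction f with
  | nil =>
    cases g
    rfl
  | skip y f ih =>
    cases g with
    | skip _ g => rw [ih (comp_unit_injective h)]
    | push b g => exact absurd h (comp_unit_ne_push _ _)
  | push a f ih =>
    cases g with
    | skip _ g => exact absurd h.symm (comp_unit_ne_push _ _)
    | push b g =>
      obtain ⟨rfl, h'⟩ := push_injective h
      rw [ih h']

/-- The dichotomy `eq_comp_unit_or_eq_push` peels off one constructor at a time, and each peeling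
shortens one of the two words. -/
theorem evalMap_corollaMon_surjective : (L L' : List SimplexCategory) →
    Function.Surjective (MonWord.evalMap corollaMon : MonWord.Hom L L' → _)
  | [], [], f => ⟨.nil, by apply hom_ext <;> intro a <;> exact a.elim⟩
  | x :: L, [], f => (Hom.mid f (toLex (Sum.inl ()))).elim
  | [], y :: L', f => by
    obtain ⟨g, hg⟩ := exists_eq_comp_unit (T := MonWord.evalObj corollaMon L') f fun m => m.elim
    obtain ⟨g', rfl⟩ := evalMap_corollaMon_surjective [] L' g
    exact ⟨.skip y g', hg.symm⟩
  | x :: L, y :: L', f => by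
    obtain ⟨g, hg⟩ | ⟨a, g, hg⟩ := eq_comp_unit_or_eq_push
      (S := MonWord.evalObj corollaMon L) (T := MonWord.evalObj corollaMon L') f
    · obtain ⟨g', rfl⟩ := evalMap_corollaMon_surjective (x :: L) L' g
      exact ⟨.skip y g', hg.symm⟩
    · obtain ⟨g', rfl⟩ := evalMap_corollaMon_surjective L (y :: L') g
      exact ⟨.push a g', hg.symm⟩

instance : ofWord.Faithful where
  map_injective h := evalMap_corollaMon_injective h

instance : ofWord.Full where
  map_surjective := evalMap_corollaMon_surjective _ _

/-! ### Decomposition of a tree into corollas -/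

/-- A monotone bijection of total orders has a monotone inverse; for leaves this is applied
fibrewise, the inverse map respecting fibres by `hcomm`. -/
theorem isIso_of_bijective {S T : PrunedTree} (f : S ⟶ T)
    (ht : Function.Bijective (Hom.top f)) (hm : Function.Bijective (Hom.mid f)) : IsIso f := by
  let t := Equiv.ofBijective _ ht
  let m := Equiv.ofBijective _ hm
  have ht' : ∀ b, Hom.top f (t.symm b) = b := t.apply_symm_apply
  have hm' : ∀ b, Hom.mid f (m.symm b) = b := m.apply_symm_apply
  have hcomm : ∀ b, S.proj (t.symm b) = m.symm (T.proj b) := fun b =>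
    hm.1 (by rw [← Hom.comm, ht', hm'])
  refine ⟨{ top := t.symm, mid := m.symm, comm := hcomm,
            mid_mono := fun i j h => ?_, top_mono := fun i j h hij => ?_ }, ?_, ?_⟩
  · by_contra hlt
    have := Hom.mid_mono f (le_of_not_ge hlt)
    rw [hm', hm'] at this
    exact hlt (by rw [le_antisymm h this])
  · by_contra hlt
    have := Hom.top_mono f _ _ (by rw [hcomm, hcomm, h]) (le_of_not_ge hlt)
    rw [ht', ht'] at this
    exact hlt (by rw [le_antisymm hij this])
  · ext b
    · exact t.symm_apply_apply b
    · exact m.symm_apply_apply b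
  · ext b
    · exact ht' b
    · exact hm' b

/-- The part of a tree above the vertices of height one other than `m`. -/
def erase (T : PrunedTree) (m : T.Mid) : PrunedTree where
  Top := {a : T.Top // T.proj a ≠ m}
  Mid := {n : T.Mid // n ≠ m}
  proj a := ⟨T.proj a.1, a.2⟩
  surj := by
    rintro ⟨n, hn⟩
    obtain ⟨a, rfl⟩ := T.surj n
    exact ⟨⟨a, hn⟩, rfl⟩

/-- A tree is the sum of its first corolla and the rest. -/
theorem exists_iso_corolla_tensor (T : PrunedTree) (m : T.Mid) (hm : ∀ n, m ≤ n) :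
    ∃ X, Nonempty (corolla X ⊗ T.erase m ≅ T) := by
  have : Fintype {a : T.Top // T.proj a = m} := Fintype.ofFinite _
  -- Surjectivity of the structure map makes the fibre nonempty, as it must be to form a corolla.
  obtain ⟨k, hk⟩ : ∃ k, Fintype.card {a : T.Top // T.proj a = m} = k + 1 := by
    obtain ⟨a, ha⟩ := T.surj m
    have : Nonempty {a : T.Top // T.proj a = m} := ⟨⟨a, ha⟩⟩
    exact ⟨_, (Nat.succ_pred_eq_of_pos Fintype.card_pos).symm⟩
  let e : Fin (k + 1) ≃o {a : T.Top // T.proj a = m} :=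
    monoEquivOfFin {a : T.Top // T.proj a = m} hk
  refine ⟨SimplexCategory.mk k, ⟨?_⟩⟩
  -- On all leaves this map need not be monotone, since fibres of `T` may interleave; only
  -- monotonicity within fibres is required.
  let f : corolla (SimplexCategory.mk k) ⊗ T.erase m ⟶ T :=
    { top := sumElim (fun i => (e i).1) (fun a => a.1)
      mid := sumElim (fun _ => m) (fun n => n.1)
      comm := by
        rintro (i | a)
        · exact (e i).2
        · rfl
      mid_mono := by
        rintro (i | a) (j | b) h
        · exact le_rfl
        · exact hm _
        · exact absurd h Sum.Lex.not_inr_le_inl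
        · exact (Sum.Lex.inr_le_inr_iff.1 h :)
      top_mono := by
        rintro (i | a) (j | b) h hab
        · exact e.monotone (Sum.Lex.inl_le_inl_iff.1 hab)
        · exact absurd (toLex.injective h) Sum.inl_ne_inr
        · exact absurd (toLex.injective h) Sum.inr_ne_inl
        · exact (Sum.Lex.inr_le_inr_iff.1 hab :) }
  have : IsIso f := by
    apply isIso_of_bijective
    · constructor
      · rintro (i | a) (j | b) h
        · exact congrArg (fun z => toLex (Sum.inl z)) (e.injective (Subtype.ext h))
        · exact absurd ((congrArg T.proj h).symm.trans (e i).2) b.2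
        · exact absurd ((congrArg T.proj h).trans (e j).2) a.2
        · exact congrArg (fun z => toLex (Sum.inr z)) (Subtype.ext h)
      · intro a
        by_cases ha : T.proj a = m
        · exact ⟨toLex (Sum.inl (e.symm ⟨a, ha⟩)),
            congrArg Subtype.val (e.apply_symm_apply ⟨a, ha⟩)⟩
        · exact ⟨toLex (Sum.inr ⟨a, ha⟩), rfl⟩
    · constructor
      · rintro (i | a) (j | b) h
        · rfl
        · exact absurd (Eq.symm h) b.2
        · exact absurd h a.2
        · exact congrArg (fun z => toLex (Sum.inr z)) (Subtype.ext h)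
      · intro n
        by_cases hn : n = m
        · exact ⟨toLex (Sum.inl ()), hn.symm⟩
        · exact ⟨toLex (Sum.inr ⟨n, hn⟩), rfl⟩
  exact asIso f

theorem exists_iso_ofWord (k : ℕ) : ∀ T : PrunedTree, Nat.card T.Mid = k →
    ∃ L : MonWord SimplexCategory, Nonempty (ofWord.obj L ≅ T) := by
  induction k with
  | zero =>
    intro T hT
    have : IsEmpty T.Mid := (Nat.card_eq_zero.1 hT).resolve_right 
      (not_infinite_iff_finite.2 T.midFinite)
    have : IsEmpty T.Top := T.proj.isEmpty
    let f : PrunedTree.unit ⟶ T :=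
      { top := Empty.elim
        mid := Empty.elim
        comm := fun a => a.elim
        mid_mono := fun a => a.elim
        top_mono := fun a => a.elim }
    have : IsIso f := isIso_of_bijective f
      ⟨fun a => a.elim, fun a => isEmptyElim a⟩ ⟨fun a => a.elim, fun a => isEmptyElim a⟩
    exact ⟨([] : List SimplexCategory), ⟨(asIso f : PrunedTree.unit ≅ T)⟩⟩
  | succ k ih =>
    intro T hT
    have : Nonempty T.Mid := (Nat.card_pos_iff.1 (by omega)).1
    obtain ⟨m, hm⟩ := Finite.exists_min (fun n : T.Mid => n)
    obtain ⟨X, ⟨e⟩⟩ := exists_iso_corolla_tensor T m hm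
    obtain ⟨L, ⟨e'⟩⟩ := ih (T.erase m) (by
      have : Fintype T.Mid := Fintype.ofFinite _
      have h := Fintype.card_subtype_compl (fun n : T.Mid => n = m)
      rw [Nat.card_eq_fintype_card] at hT
      change Nat.card {n : T.Mid // n ≠ m} = k
      rw [Nat.card_eq_fintype_card]
      simp only [Fintype.card_subtype_eq] at h
      change Fintype.card {n : T.Mid // n ≠ m} = _ at h
      omega)
    exact ⟨(X :: L : List SimplexCategory), ⟨whiskerLeftIso (corolla X) e' ≪≫ e⟩⟩

instance : ofWord.EssSurj where
  mem_essImage T := exists_iso_ofWord _ T rfl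

instance : ofWord.IsEquivalence where

end PrunedTree

/-! ### The monoidal category of words -/

/-- The data needed to induce a monoidal structure, with the equations in the form of those of a
monoidal functor. -/
def CategoryTheory.Monoidal.InducingFunctorData.ofIso {D : Type u'} [Category.{v'} D]
    [MonoidalCategoryStruct D] {C : Type u} [Category.{v} C] [MonoidalCategory C] (F : D ⥤ C)
    (εIso : 𝟙_ C ≅ F.obj (𝟙_ D)) (μIso : ∀ X Y, F.obj X ⊗ F.obj Y ≅ F.obj (X ⊗ Y))
    (tensorHom_eq : ∀ {X X' Y Y' : D} (f : X ⟶ X') (g : Y ⟶ Y'), f ⊗ₘ g = f ▷ Y ≫ X' ◁ g)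
    (natural_left : ∀ {X Y : D} (f : X ⟶ Y) (Z : D),
      F.map f ▷ F.obj Z ≫ (μIso Y Z).hom = (μIso X Z).hom ≫ F.map (f ▷ Z))
    (natural_right : ∀ (Z : D) {X Y : D} (f : X ⟶ Y),
      F.obj Z ◁ F.map f ≫ (μIso Z Y).hom = (μIso Z X).hom ≫ F.map (Z ◁ f))
    (associativity : ∀ X Y Z : D,
      (μIso X Y).hom ▷ F.obj Z ≫ (μIso (X ⊗ Y) Z).hom ≫ F.map (α_ X Y Z).hom =
        (α_ _ _ _).hom ≫ F.obj X ◁ (μIso Y Z).hom ≫ (μIso X (Y ⊗ Z)).hom)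
    (left_unitality : ∀ X : D,
      (λ_ (F.obj X)).hom = εIso.hom ▷ F.obj X ≫ (μIso (𝟙_ D) X).hom ≫ F.map (λ_ X).hom)
    (right_unitality : ∀ X : D,
      (ρ_ (F.obj X)).hom = F.obj X ◁ εIso.hom ≫ (μIso X (𝟙_ D)).hom ≫ F.map (ρ_ X).hom) :
    Monoidal.InducingFunctorData F where
  μIso := μIso
  εIso := εIso
  whiskerLeft_eq X _ _ f := by simp [natural_right X f]
  whiskerRight_eq f X := by simp [natural_left f X]
  tensorHom_eq f g := by
    rw [tensorHom_eq, Functor.map_comp, MonoidalCategory.tensorHom_def, Iso.eq_inv_comp,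
      ← reassoc_of% natural_left f, Category.assoc, natural_right]
  associator_eq X Y Z := by simp [← associativity X Y Z]
  leftUnitor_eq X := by simp [left_unitality X]
  rightUnitor_eq X := by simp [right_unitality X]

namespace MonWord

section

variable {A : Type u'} [Category.{v'} A] {C : Type u} [Category.{v} C] [MonoidalCategory C]

theorem eval_left_unitality (M : A ⥤ Mon C) (L : MonWord A) :
    (λ_ ((eval M).obj L)).hom = (Iso.refl (𝟙_ C)).hom ▷ (eval M).obj L ≫
      (evalTensorIso M [] L).hom ≫ (eval M).map (λ_ L).hom := by
  have : (eval M).map (λ_ L).hom = 𝟙 _ := (eval M).map_id L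
  rw [this, Iso.refl_hom, id_whiskerRight]
  exact ((Category.id_comp _).trans (Category.comp_id _)).symm

theorem eval_right_unitality (M : A ⥤ Mon C) (L : MonWord A) :
    (ρ_ ((eval M).obj L)).hom = (eval M).obj L ◁ (Iso.refl (𝟙_ C)).hom ≫
      (evalTensorIso M L []).hom ≫ (eval M).map (ρ_ L).hom := by
  rw [Iso.refl_hom, whiskerLeft_id]
  exact (evalTensorIso_rightUnit M L).trans (Category.id_comp _).symm

end

/-- The monoidal structure on words is detected by trees. -/
def inducingData : Monoidal.InducingFunctorData PrunedTree.ofWord :=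
  .ofIso PrunedTree.ofWord (Iso.refl _) (evalTensorIso PrunedTree.corollaMon)
    (fun _ _ => rfl)
    (fun f L => evalTensorIso_naturality_left PrunedTree.corollaMon f L)
    (fun L _ _ f => evalTensorIso_naturality_right PrunedTree.corollaMon L f)
    (evalTensorIso_associativity PrunedTree.corollaMon)
    (eval_left_unitality PrunedTree.corollaMon)
    (eval_right_unitality PrunedTree.corollaMon)

/-- The coherence axioms hold for trees and are reflected by the faithful functor `ofWord`. -/
instance : MonoidalCategory (MonWord SimplexCategory) := Monoidal.induced _ inducingData

variable {C : Type u} [Category.{v} C] [MonoidalCategory C]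

/-- The interpretation of words is monoidal. -/
def evalCoreMonoidal (M : SimplexCategory ⥤ Mon C) : (eval M).CoreMonoidal where
  εIso := Iso.refl _
  μIso := evalTensorIso M
  μIso_hom_natural_left f N := evalTensorIso_naturality_left M f N
  μIso_hom_natural_right N f := evalTensorIso_naturality_right M N f
  associativity := evalTensorIso_associativity M
  left_unitality := eval_left_unitality M
  right_unitality := eval_right_unitality M

instance (M : SimplexCategory ⥤ Mon C) : (eval M).Monoidal := (evalCoreMonoidal M).toMonoidal

instance ofWordMonoidal : PrunedTree.ofWord.Monoidal :=
  (evalCoreMonoidal PrunedTree.corollaMon).toMonoidal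

/-- The word with a single letter. -/
def letter (x : SimplexCategory) : MonWord SimplexCategory := [x]

/-- A word with a single letter is a monoid. -/
instance letterMonObj (x : SimplexCategory) : MonObj (letter x) where
  one := Hom.skip x .nil
  -- The innermost `skip` supplies a unit, into which both letters are then multiplied.
  mul := Hom.push (𝟙 x) (.push (𝟙 x) (.skip x .nil))
  one_mul := by
    change Hom.comp (Hom.whiskerRight (Hom.skip x .nil) [x])
      (Hom.push (𝟙 x) (.push (𝟙 x) (.skip x .nil))) = Hom.id [x]
    simp [Hom.whiskerRight, Hom.id, Hom.cons]
  mul_one := by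
    change Hom.comp (Hom.whiskerLeft [x] (Hom.skip x .nil))
      (Hom.push (𝟙 x) (.push (𝟙 x) (.skip x .nil))) = Hom.cons x (Hom.id [])
    simp [Hom.whiskerLeft, Hom.id, Hom.cons]
  mul_assoc := by
    change Hom.comp (Hom.whiskerRight (Hom.push (𝟙 x) (.push (𝟙 x) (.skip x .nil))) [x])
      (Hom.push (𝟙 x) (.push (𝟙 x) (.skip x .nil))) =
        Hom.comp (Hom.cons x (Hom.id [x, x]))
          (Hom.comp (Hom.whiskerLeft [x] (Hom.push (𝟙 x) (.push (𝟙 x) (.skip x .nil))))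
      (Hom.push (𝟙 x) (.push (𝟙 x) (.skip x .nil))))
    simp [Hom.whiskerRight, Hom.whiskerLeft, Hom.id, Hom.cons]

/-- The map of letters induced by a map of indices. -/
def letterMap {x y : SimplexCategory} (a : x ⟶ y) : letter x ⟶ letter y :=
  Hom.push a (.skip y .nil)

instance {x y : SimplexCategory} (a : x ⟶ y) : IsMonHom (letterMap a) where
  one_hom := by
    change Hom.comp (Hom.skip x .nil) (Hom.push a (.skip y .nil)) = Hom.skip y .nil
    simp
  mul_hom := by
    change Hom.comp (Hom.push (𝟙 x) (.push (𝟙 x) (.skip x .nil))) (Hom.push a (.skip y .nil)) =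
      Hom.comp (Hom.comp (Hom.whiskerRight (Hom.push a (.skip y .nil)) [x])
        (Hom.whiskerLeft [y] (Hom.push a (.skip y .nil))))
        (Hom.push (𝟙 y) (.push (𝟙 y) (.skip y .nil)))
    simp [Hom.whiskerRight, Hom.whiskerLeft, Hom.id, Hom.cons]

/-- The cosimplicial monoid of letters. -/
def letters : SimplexCategory ⥤ Mon (MonWord SimplexCategory) where
  obj x := Mon.mk (letter x)
  map a := Mon.Hom.mk (letterMap a)
  map_id _ := rfl
  map_comp {x y z} a b := by
    apply Mon.Hom.ext'
    change Hom.push (a ≫ b) (.skip z .nil) =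
      Hom.comp (Hom.push a (.skip y .nil)) (Hom.push b (.skip z .nil))
    simp

end MonWord

/-! ### Evaluation of one-letter words -/

namespace FreeMod

open scoped MonObj

variable {C : Type u} [Category.{v} C] [MonoidalCategory C] (Y : C) [MonObj Y]

/-- A one-letter word evaluates to `Y ⊗ 𝟙_ C`, hence the right unitor. The identities are kept so
that the left side is definitionally the unit of the image monoid. -/
theorem one_rightUnitor : (𝟙 (𝟙_ C) ≫ (𝟙 (𝟙_ C) ≫ unit Y (𝟙_ C))) ≫ (ρ_ Y).hom = η[Y] := by
  simp [unit, ← unitors_equal]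

theorem mul_rightUnitor :
    (((α_ Y (𝟙_ C) (Y ⊗ 𝟙_ C)).hom ≫ Y ◁ (λ_ (Y ⊗ 𝟙_ C)).hom) ≫
        push (𝟙 Y) (push (𝟙 Y) (𝟙 (𝟙_ C) ≫ unit Y (𝟙_ C)))) ≫ (ρ_ Y).hom =
      ((ρ_ Y).hom ⊗ₘ (ρ_ Y).hom) ≫ μ[Y] := by
  rw [push_id_unit, whiskerLeft_id]
  simp only [push, whiskerLeft_id, id_whiskerRight, Category.id_comp, act, Category.assoc,
    rightUnitor_naturality]
  simp [MonoidalCategory.tensorHom_def]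

omit [MonObj Y] in
variable {Y} in
theorem push_rightUnitor {Z : C} [MonObj Z] (a : Y ⟶ Z) :
    push a (𝟙 (𝟙_ C) ≫ unit Z (𝟙_ C)) ≫ (ρ_ Z).hom = (ρ_ Y).hom ≫ a := by
  rw [push, whisker_exchange_assoc, Category.id_comp, whiskerLeft_unit_act]
  simp

end FreeMod

namespace MonWord

variable {C : Type u} [Category.{v} C] [MonoidalCategory C] (M : SimplexCategory ⥤ Mon C)

/-- The interpretation of a letter is the corresponding monoid. -/
def lettersEvalIsoApp (x : SimplexCategory) : (letters ⋙ (eval M).mapMon).obj x ≅ M.obj x :=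
  Mon.mkIso (ρ_ (M.obj x).X) (FreeMod.one_rightUnitor (M.obj x).X)
    (by
      have h := FreeMod.mul_rightUnitor (M.obj x).X
      -- The multiplication of letters pushes along `𝟙 x`, so its interpretation contains the image
      -- of `𝟙 x` under `M` where `h` has an identity.
      rw [← Mon.id_hom', ← M.map_id] at h
      exact h)

/-- The interpretation of the cosimplicial monoid of letters. -/
def lettersEvalIso : letters ⋙ (eval M).mapMon ≅ M :=
  NatIso.ofComponents (lettersEvalIsoApp M) fun {x y} a => by
    apply Mon.Hom.ext'
    exact FreeMod.push_rightUnitor (M.map a).hom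

end MonWord

/-! ### Extension of maps of cosimplicial monoids -/

namespace FreeMod

open Functor.LaxMonoidal
open Functor.OplaxMonoidal (δ η)

variable {D : Type u'} [Category.{v'} D] [MonoidalCategory D]
  {C : Type u} [Category.{v} C] [MonoidalCategory C] (F G : D ⥤ C) [F.Monoidal] [G.Monoidal]

/-- The map `F (Y ⊗ X) ⟶ G (Y ⊗ X)` with components `p : F Y ⟶ G Y` and `t : F X ⟶ G X`. -/
def glue {Y X : D} (p : F.obj Y ⟶ G.obj Y) (t : F.obj X ⟶ G.obj X) :
    F.obj (Y ⊗ X) ⟶ G.obj (Y ⊗ X) :=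
  δ F Y X ≫ (p ⊗ₘ t) ≫ μ G Y X

variable {F G}

theorem μ_glue {Y X : D} (p : F.obj Y ⟶ G.obj Y) (t : F.obj X ⟶ G.obj X) :
    μ F Y X ≫ glue F G p t = (p ⊗ₘ t) ≫ μ G Y X := by
  simp [glue]

theorem glue_naturality {Y Y' X X' : D} {p : F.obj Y ⟶ G.obj Y} {p' : F.obj Y' ⟶ G.obj Y'}
    {t : F.obj X ⟶ G.obj X} {t' : F.obj X' ⟶ G.obj X'} {a : Y ⟶ Y'} {f : X ⟶ X'}
    (ha : F.map a ≫ p' = p ≫ G.map a) (hf : F.map f ≫ t' = t ≫ G.map f) :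
    F.map (a ⊗ₘ f) ≫ glue F G p' t' = glue F G p t ≫ G.map (a ⊗ₘ f) := by
  rw [← cancel_epi (μ F Y X), ← reassoc_of% μ_natural F, μ_glue, reassoc_of% μ_glue,
    ← μ_natural, tensorHom_comp_tensorHom_assoc, tensorHom_comp_tensorHom_assoc, ha, hf]

theorem glue_leftUnitor {X : D} (t : F.obj X ⟶ G.obj X) :
    μ F (𝟙_ D) X ≫ F.map (λ_ X).hom ≫ t =
      ((η F ≫ ε G) ⊗ₘ t) ≫ μ G (𝟙_ D) X ≫ G.map (λ_ X).hom := by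
  rw [← cancel_epi (ε F ▷ F.obj X), ← reassoc_of% left_unitality F X,
    ← tensorHom_id, tensorHom_comp_tensorHom_assoc]
  simp only [Functor.Monoidal.ε_η_assoc, Category.id_comp]
  rw [tensorHom_def', Category.assoc, ← left_unitality, leftUnitor_naturality]

/-- The inductive step of `μ_extendApp`: compatibility with the tensor product passes from `X` to `Y
⊗ X`. -/
theorem glue_associator {Y X X' R : D} (p : F.obj Y ⟶ G.obj Y) (e : X ⊗ X' ⟶ R)
    (t : F.obj X ⟶ G.obj X) (t' : F.obj X' ⟶ G.obj X') (t'' : F.obj R ⟶ G.obj R)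
    (h : μ F X X' ≫ F.map e ≫ t'' = (t ⊗ₘ t') ≫ μ G X X' ≫ G.map e) :
    μ F (Y ⊗ X) X' ≫ F.map ((α_ Y X X').hom ≫ Y ◁ e) ≫ glue F G p t'' =
      (glue F G p t ⊗ₘ t') ≫ μ G (Y ⊗ X) X' ≫ G.map ((α_ Y X X').hom ≫ Y ◁ e) := by
  have h₁ : μ F Y X ▷ F.obj X' ≫ (glue F G p t ⊗ₘ t') =
      ((p ⊗ₘ t) ⊗ₘ t') ≫ μ G Y X ▷ G.obj X' := by
    rw [← tensorHom_id, ← tensorHom_id, tensorHom_comp_tensorHom, tensorHom_comp_tensorHom, μ_glue,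
      Category.id_comp, Category.comp_id]
  have h₂ : F.obj Y ◁ (μ F X X' ≫ F.map e) ≫ (p ⊗ₘ t'') =
      (p ⊗ₘ (t ⊗ₘ t')) ≫ G.obj Y ◁ (μ G X X' ≫ G.map e) := by
    rw [← id_tensorHom, ← id_tensorHom, tensorHom_comp_tensorHom, tensorHom_comp_tensorHom,
      Category.id_comp, Category.comp_id, Category.assoc, h]
  rw [← cancel_epi (μ F Y X ▷ F.obj X'), reassoc_of% h₁]
  simp only [Functor.map_comp, Category.assoc, associativity_assoc, ← μ_natural_right_assoc, μ_glue,
    ← μ_natural_right]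
  rw [← whiskerLeft_comp_assoc, reassoc_of% h₂, ← whiskerLeft_comp_assoc,
    associator_naturality_assoc]

open scoped Obj

variable {Y : D} [MonObj Y] (p : F.obj Y ⟶ G.obj Y) [IsMonHom p]

/-- Naturality with respect to inserting a unit holds because `p` preserves units; for `act_glue`
the reason is that `p` preserves products. -/
theorem unit_glue {X : D} (t : F.obj X ⟶ G.obj X) :
    F.map (unit Y X) ≫ glue F G p t = t ≫ G.map (unit Y X) := by
  have h : ε F ≫ F.map MonObj.one ≫ p = ε G ≫ G.map MonObj.one := by
    simpa using IsMonHom.one_hom p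
  simp only [unit, Functor.map_comp, Category.assoc, ← left_unitality_inv,
    μ_glue, ← μ_natural_left]
  simp only [← comp_whiskerRight_assoc]
  rw [← tensorHom_id, tensorHom_comp_tensorHom_assoc, Category.assoc, h, Category.id_comp,
    tensorHom_def', Category.assoc, leftUnitor_inv_naturality_assoc]

theorem act_glue {X : D} (t : F.obj X ⟶ G.obj X) :
    F.map (act Y X) ≫ glue F G p t = glue F G p (glue F G p t) ≫ G.map (act Y X) := by
  have h : μ F Y Y ≫ F.map MonObj.mul ≫ p = (p ⊗ₘ p) ≫ μ G Y Y ≫ G.map MonObj.mul := by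
    simpa using IsMonHom.mul_hom p
  have h₁ : F.obj Y ◁ μ F Y X ≫ (p ⊗ₘ glue F G p t) =
      (p ⊗ₘ (p ⊗ₘ t)) ≫ G.obj Y ◁ μ G Y X := by
    rw [← id_tensorHom, ← id_tensorHom, tensorHom_comp_tensorHom, tensorHom_comp_tensorHom, μ_glue,
      Category.id_comp, Category.comp_id]
  have h₂ : (μ F Y Y ≫ F.map MonObj.mul) ▷ F.obj X ≫ (p ⊗ₘ t) =
      ((p ⊗ₘ p) ⊗ₘ t) ≫ (μ G Y Y ≫ G.map MonObj.mul) ▷ G.obj X := by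
    rw [← tensorHom_id, ← tensorHom_id, tensorHom_comp_tensorHom, tensorHom_comp_tensorHom,
      Category.id_comp, Category.comp_id, Category.assoc, h]
  -- Precomposing with this isomorphism turns both nested `glue`s into plain tensor products of
  -- maps.
  rw [← cancel_epi (F.obj Y ◁ μ F Y X ≫ μ F Y (Y ⊗ X))]
  simp only [Category.assoc, reassoc_of% @μ_glue]
  rw [reassoc_of% h₁]
  simp only [act, Functor.map_comp, Category.assoc, associativity_inv_assoc,
    ← μ_natural_left_assoc, μ_glue, ← μ_natural_left]
  rw [← comp_whiskerRight_assoc, reassoc_of% h₂, ← comp_whiskerRight_assoc,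
    associator_inv_naturality_assoc]

theorem comp_unit_glue {Y : Mon D} (p : F.mapMon.obj Y ⟶ G.mapMon.obj Y) {X X' : D}
    {t : F.obj X ⟶ G.obj X} {t' : F.obj X' ⟶ G.obj X'} {f : X ⟶ X'}
    (hf : F.map f ≫ t' = t ≫ G.map f) :
    F.map (f ≫ unit Y.X X') ≫ glue F G p.hom t' = t ≫ G.map (f ≫ unit Y.X X') := by
  have : IsMonHom (show F.obj Y.X ⟶ G.obj Y.X from p.hom) := p.isMonHom_hom
  rw [Functor.map_comp, Functor.map_comp, Category.assoc, reassoc_of% hf.symm]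
  exact congrArg _ (unit_glue p.hom t')

theorem push_glue {Y Z : Mon D} (p : F.mapMon.obj Y ⟶ G.mapMon.obj Y)
    (q : F.mapMon.obj Z ⟶ G.mapMon.obj Z) {a : Z ⟶ Y}
    (ha : F.mapMon.map a ≫ p = q ≫ G.mapMon.map a) {X X' : D} {t : F.obj X ⟶ G.obj X}
    {t' : F.obj X' ⟶ G.obj X'} {f : X ⟶ Y.X ⊗ X'}
    (hf : F.map f ≫ glue F G p.hom t' = t ≫ G.map f) :
    F.map (push a.hom f) ≫ glue F G p.hom t' = glue F G q.hom t ≫ G.map (push a.hom f) := by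
  have : IsMonHom (show F.obj Y.X ⟶ G.obj Y.X from p.hom) := p.isMonHom_hom
  have ha' : F.map a.hom ≫ (show F.obj Y.X ⟶ G.obj Y.X from p.hom) =
    (show F.obj Z.X ⟶ G.obj Z.X from q.hom) ≫ G.map a.hom := congrArg Mon.Hom.hom ha
  rw [push, ← tensorHom_def'_assoc, Functor.map_comp, Functor.map_comp, Category.assoc]
  refine (congrArg _ (act_glue p.hom t')).trans ?_
  exact (reassoc_of% glue_naturality ha' hf) _

omit [MonObj Y] [IsMonHom p] in
theorem glue_rightUnitor :
    glue F G p (η F ≫ ε G) ≫ G.map (ρ_ Y).hom = F.map (ρ_ Y).hom ≫ p := by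
  rw [← cancel_epi (μ F Y (𝟙_ D)), reassoc_of% μ_glue, ← cancel_epi (F.obj Y ◁ ε F),
    ← reassoc_of% right_unitality F Y, ← id_tensorHom, tensorHom_comp_tensorHom_assoc]
  simp only [Functor.Monoidal.ε_η_assoc, Category.id_comp]
  rw [MonoidalCategory.tensorHom_def, Category.assoc, ← right_unitality, rightUnitor_naturality]

end FreeMod

namespace MonWord

open Functor.LaxMonoidal
open Functor.OplaxMonoidal (δ η)

section Extension

variable {D : Type u'} [Category.{v'} D] [MonoidalCategory D]
  {C : Type u} [Category.{v} C] [MonoidalCategory C] (M : SimplexCategory ⥤ Mon D) {F G : D ⥤ C}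
  [F.Monoidal] [G.Monoidal] (φ : M ⋙ F.mapMon ⟶ M ⋙ G.mapMon)

/-- The components at tensor products of monoids of the monoidal transformation extending a map
of cosimplicial monoids. -/
def extendApp : (L : List SimplexCategory) → (F.obj (evalObj M L) ⟶ G.obj (evalObj M L))
  -- The unit axiom of a monoidal transformation forces this value.
  | [] => η F ≫ ε G
  | x :: L => FreeMod.glue F G (φ.app x).hom (extendApp L)

/-- For `skip` it suffices that the components of `φ` preserve units; for `push` both
multiplicativity and the naturality of `φ` enter. -/
theorem extendApp_naturality {L L' : List SimplexCategory} (f : Hom L L') :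
    F.map (evalMap M f) ≫ extendApp M φ L' = extendApp M φ L ≫ G.map (evalMap M f) := by
  induction f with
  | nil =>
    rw [evalMap_nil, F.map_id, G.map_id]
    exact (Category.id_comp _).trans (Category.comp_id _).symm
  | skip y f ih => exact FreeMod.comp_unit_glue (F := F) (G := G) (Y := M.obj y) (φ.app y) ih
  | @push x y _ _ a f ih =>
    exact FreeMod.push_glue (F := F) (G := G) (Y := M.obj y) (Z := M.obj x) (φ.app y) (φ.app x)
      (φ.naturality a) ih

theorem μ_extendApp (L L' : List SimplexCategory) :
    μ F (evalObj M L) (evalObj M L') ≫ F.map (evalTensorIso M L L').hom ≫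
        extendApp M φ (L ++ L') =
      (extendApp M φ L ⊗ₘ extendApp M φ L') ≫ μ G (evalObj M L) (evalObj M L') ≫
        G.map (evalTensorIso M L L').hom := by
  induction L with
  | nil => exact FreeMod.glue_leftUnitor (extendApp M φ L')
  | cons x L ih => exact FreeMod.glue_associator (φ.app x).hom _ _ _ _ ih

/-- The transformation of interpretations extending a map of cosimplicial monoids. -/
def extend : eval M ⋙ F ⟶ eval M ⋙ G where
  app L := extendApp M φ L
  naturality _ _ f := extendApp_naturality M φ f

end Extension

end MonWord

/-! ### Transformations and functors out of trees -/

namespace PrunedTree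

open Functor.LaxMonoidal
open Functor.OplaxMonoidal (δ η)

variable {C : Type u} [Category.{v} C] [MonoidalCategory C]

section

variable {F G : PrunedTree ⥤ C} [F.Monoidal] [G.Monoidal]

/-- The unit and tensor axioms determine a component on a word from those on its letters, since `ε
F` and `μ F` are invertible. -/
theorem app_ofWord_ext {τ τ' : F ⟶ G} [NatTrans.IsMonoidal τ] [NatTrans.IsMonoidal τ']
    (h : ∀ x, τ.app (corolla x) = τ'.app (corolla x)) (L : List SimplexCategory) :
    τ.app (MonWord.evalObj corollaMon L) = τ'.app (MonWord.evalObj corollaMon L) := by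
  induction L with
  | nil =>
    have h₁ : ε F ≫ τ.app (𝟙_ PrunedTree) = ε G := NatTrans.IsMonoidal.unit
    have h₂ : ε F ≫ τ'.app (𝟙_ PrunedTree) = ε G := NatTrans.IsMonoidal.unit
    exact (cancel_epi (ε F)).1 (h₁.trans h₂.symm)
  | cons x L ih =>
    have h₁ := NatTrans.IsMonoidal.tensor (τ := τ) (corolla x) (MonWord.evalObj corollaMon L)
    have h₂ := NatTrans.IsMonoidal.tensor (τ := τ') (corolla x) (MonWord.evalObj corollaMon L)
    rw [h, ih, ← h₂] at h₁
    exact (cancel_epi (μ F _ _)).1 h₁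

/-- A monoidal transformation is determined by its components at corollas. -/
theorem natTrans_ext {τ τ' : F ⟶ G} [NatTrans.IsMonoidal τ] [NatTrans.IsMonoidal τ']
    (h : ∀ x, τ.app (corolla x) = τ'.app (corolla x)) : τ = τ' := by
  ext T
  obtain ⟨L, ⟨e⟩⟩ := Functor.EssSurj.mem_essImage (F := ofWord) T
  rw [← cancel_epi (F.map e.hom), τ.naturality, τ'.naturality]
  exact congrArg (· ≫ G.map e.hom) (app_ofWord_ext h L)

/-- A transformation is monoidal if it is so on words. -/
theorem isMonoidal_of_ofWord (τ : F ⟶ G) (hε : ε F ≫ τ.app (𝟙_ PrunedTree) = ε G)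
    (hμ : ∀ L L' : MonWord SimplexCategory, μ F (ofWord.obj L) (ofWord.obj L') ≫
      τ.app (ofWord.obj L ⊗ ofWord.obj L') =
        (τ.app (ofWord.obj L) ⊗ₘ τ.app (ofWord.obj L')) ≫ μ G (ofWord.obj L) (ofWord.obj L')) :
    NatTrans.IsMonoidal τ where
  unit := hε
  tensor S T := by
    obtain ⟨L, ⟨e⟩⟩ := Functor.EssSurj.mem_essImage (F := ofWord) S
    obtain ⟨L', ⟨e'⟩⟩ := Functor.EssSurj.mem_essImage (F := ofWord) T
    rw [← cancel_epi (F.map e.hom ⊗ₘ F.map e'.hom), reassoc_of% μ_natural F, τ.naturality,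
      reassoc_of% hμ, ← μ_natural, tensorHom_comp_tensorHom_assoc, tensorHom_comp_tensorHom_assoc,
      τ.naturality, τ.naturality]

/-- Restriction along the equivalence `ofWord` is full on transformations, so the extension to words
lifts to all trees. -/
theorem exists_extension (φ : corollaMon ⋙ F.mapMon ⟶
      corollaMon ⋙ G.mapMon) :
    ∃ τ : F ⟶ G, NatTrans.IsMonoidal τ ∧ ∀ x, τ.app (corolla x) = (φ.app x).hom := by
  obtain ⟨τ, hτ⟩ := ((Functor.whiskeringLeft _ _ C).obj ofWord).map_surjective
    (MonWord.extend corollaMon φ)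
  have hτ' : ∀ L : List SimplexCategory, τ.app (MonWord.evalObj corollaMon L) =
      MonWord.extendApp corollaMon φ L := fun L => NatTrans.congr_app hτ L
  have hunit : ε F ≫ τ.app (𝟙_ PrunedTree) = ε G := by
    refine (congrArg (ε F ≫ ·) (hτ' [])).trans ?_
    exact Functor.Monoidal.ε_η_assoc F _
  have hmon : NatTrans.IsMonoidal τ := by
    refine isMonoidal_of_ofWord τ hunit fun (L L' : List SimplexCategory) => ?_
    change μ F (MonWord.evalObj corollaMon L) (MonWord.evalObj corollaMon L') ≫
      τ.app (MonWord.evalObj corollaMon L ⊗ MonWord.evalObj corollaMon L') =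
        (τ.app (MonWord.evalObj corollaMon L) ⊗ₘ τ.app (MonWord.evalObj corollaMon L')) ≫
          μ G (MonWord.evalObj corollaMon L) (MonWord.evalObj corollaMon L')
    have h := MonWord.μ_extendApp corollaMon φ L L'
    rw [← hτ', ← hτ', ← hτ', τ.naturality] at h
    rw [← cancel_mono (G.map (MonWord.evalTensorIso corollaMon L L').hom), Category.assoc,
      Category.assoc]
    exact h
  refine ⟨τ, hmon, fun x => ?_⟩
  let p : F.obj (corolla x) ⟶ G.obj (corolla x) := (φ.app x).hom
  change τ.app (corolla x) = p
  -- The word `[x]` gives `corolla x ⊗ 𝟙_`, so its component is compared with that of `corolla x`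
  -- through the right unitor.
  have h := hτ' [x]
  have h₁ : F.map (ρ_ (corolla x)).hom ≫ τ.app (corolla x) =
      τ.app (corolla x ⊗ 𝟙_ _) ≫ G.map (ρ_ (corolla x)).hom := τ.naturality _
  have h₂ : FreeMod.glue F G p (η F ≫ ε G) ≫ G.map (ρ_ (corolla x)).hom =
      F.map (ρ_ (corolla x)).hom ≫ p := FreeMod.glue_rightUnitor _
  rw [← cancel_epi (F.map (ρ_ (corolla x)).hom), ← h₂, h₁]
  exact congrArg (· ≫ G.map (ρ_ (corolla x)).hom) h

end

/-- The inverse of a monoidal equivalence is monoidal, and the unit of the equivalence lifts to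
monoids. -/
theorem exists_mapMon_inverse {D : Type u'} [Category.{v'} D] [MonoidalCategory D] (e : D ≌ C)
    [e.functor.Monoidal] :
    ∃ (S : C ⥤ D) (_ : S.Monoidal), Nonempty (e.functor.mapMon ⋙ S.mapMon ≅ 𝟭 (Mon D)) := by
  let : e.inverse.Monoidal := e.inverseMonoidal
  have : e.IsMonoidal := ⟨rfl, fun _ _ => rfl⟩
  exact ⟨e.inverse, inferInstance, ⟨e.mapMon.unitIso.symm⟩⟩

/-- Every cosimplicial monoid is the image of the cosimplicial monoid of corollas under a
monoidal functor. -/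
theorem exists_evaluation_iso (M : CosimplicialObject (Mon C)) :
    ∃ F : StrongMonoidalFunctor PrunedTree C,
      Nonempty ((evaluationAtCorollas C).obj F ≅ M) := by
  let K : SimplexCategory ⥤ Mon C := M
  obtain ⟨S, hS, ⟨e⟩⟩ : ∃ (S : PrunedTree ⥤ MonWord SimplexCategory) (_ : S.Monoidal),
      Nonempty (ofWord.mapMon ⋙ S.mapMon ≅ 𝟭 _) :=
    @exists_mapMon_inverse _ _ _ _ _ _ ofWord.asEquivalence MonWord.ofWordMonoidal
  let k : MonWord.letters ⋙ ofWord.mapMon ≅ corollaMon := MonWord.lettersEvalIso corollaMon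
  -- As `ofWord` sends letters to corollas, its inverse `S` sends corollas back to letters, which
  -- `eval K` then interprets as `K`.
  let i : corollaMon ⋙ S.mapMon ≅ MonWord.letters :=
    Functor.isoWhiskerRight k.symm S.mapMon ≪≫ Functor.isoWhiskerLeft MonWord.letters e
  let j : corollaMon ⋙ (S ⋙ MonWord.eval K).mapMon ≅ K :=
    Functor.isoWhiskerLeft _ Functor.mapMonCompIso ≪≫
      Functor.isoWhiskerRight i (MonWord.eval K).mapMon ≪≫ MonWord.lettersEvalIso K
  exact ⟨⟨S ⋙ MonWord.eval K⟩, ⟨j⟩⟩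

end PrunedTree

theorem mainTheorem6 (C : Type u) [Category.{v} C] [MonoidalCategory C] :
    (evaluationAtCorollas C).IsEquivalence := by
  have : (evaluationAtCorollas C).Faithful :=
    { map_injective := fun {F G f g} h => StrongMonoidalFunctor.Hom.ext <|
        PrunedTree.natTrans_ext fun x => congrArg Mon.Hom.hom (NatTrans.congr_app h x) }
  have : (evaluationAtCorollas C).Full :=
    { map_surjective := fun {F G} φ => by
        obtain ⟨τ, hτ, h⟩ := PrunedTree.exists_extension φ
        refine ⟨{ hom := τ }, ?_⟩
        apply NatTrans.ext
        funext x
        exact Mon.Hom.ext' (h x) }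
  have : (evaluationAtCorollas C).EssSurj := ⟨PrunedTree.exists_evaluation_iso⟩
  exact { }
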